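/- **Setting.** Let $M$ be a compact connected finite-dimensional smooth Riemannian manifold (without boundary), with the induced Riemannian distance and balls $B_r(x)$, and let $\mathrm{Leb}$ be a normalised volume on $M$, i.e. a Borel probability measure which in every smooth chart has a smooth, strictly positive density with respect to Lebesgue measure (for instance the normalised Riemannian volume). Let $X$ be a compact metric space, $\theta$ a Borel probability measure on $X$, and $F:M\times X\to M$ a (jointly) measurable map; write $f_\omega(x)=f^x(\omega)=F(x,\omega)$. The pair $((f_\omega)_{\omega\in X},\theta)$ is called a *random perturbation* of $f:M\to M$ if 1. there are $\omega^*\in X$ and $\varepsilon_0>0$ such that $f_{\omega^*}=f$ and $\operatorname{supp}\theta$ contains the ball of radius $\varepsilon_0$ around $\omega^*$; and there is $\rho_0>0$ such that for $\mathrm{Leb}$-a.e. $x\in M$ the perturbed images of $x$ cover $B_{\rho_0}(f(x))$, in the sense that $\operatorname{supp}(f^x_*\theta)\supset B_{\rho_0}(f(x))$ (if $f^x$ is continuous, this holds as soon as $f^x(\operatorname{supp}\theta)\supset B_{\rho_0}(f(x))$); 2. there are constants $\overline q>\underline q>0$ such that for $\mathrm{Leb}$-a.e. $x$ one has $f^x_*\theta=q_x\,\mathrm{Leb}$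 with $\underline q\le q_x\le\overline q$ $\mathrm{Leb}$-a.e. on $\operatorname{supp}(f^x_*\theta)$. For $\underline\omega=(\omega_1,\omega_2,\dots)\in X^{\mathbb N}$ put $f^n_{\underline\omega}=f_{\omega_n}\circ\cdots\circ f_{\omega_1}$ and $f^0_{\underline\omega}=\mathrm{id}$. A Borel probability measure $\mu$ on $M$ is *stationary* if $\int\!\int\varphi\circ f_\omega\,d\mu\,d\theta(\omega)=\int\varphi\,d\mu$ for every $\mu$-integrable $\varphi:M\to\mathbb R$. **Theorem A.** Let $f:M\to M$ be a measurable map that is continuous at $\mathrm{Leb}$-a.e. point, and suppose that there is $x_0\in M$ such that $\{f^n x_0:n\ge1\}$ is dense in $M$ and consists of continuity points of $f$. Then every random perturbation $((f_\omega),\theta)$ of $f$ has exactly one stationary probability measure $\mu$ with $\mu\ll\mathrm{Leb}$, and it has exponential annealed decay of correlations against $L^1$ observables with respect to $\mu\times\theta^{\mathbb N}$: there are $C>0$ and $\lambda>1$ such that for all $n\ge0$ and all non-zero $\phi\in L^\infty(\mathrm{Leb})$, $\psi\in L^1(\mathrm{Leb})$, $$\frac{1}{\|\phi\|_{\infty}\|\psi\|_{1}}\left|\int\Big(\int\psi\circ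 f^n_{\underline\omega}\,d\theta^{\mathbb N}(\underline\omega)\Big)\phi\,d\mu-\int\phi\,d\mu\int\psi\,d\mu\right|\le C\lambda^{-n},$$ where the norms are taken with respect to $\mathrm{Leb}$ and all integrals converge; and the same holds, with the corresponding norms, for $\phi\in L^1(\mathrm{Leb})$ and $\psi\in L^\infty(\mathrm{Leb})$. -/

import Mathlib

open MeasureTheory Set Filter Topology
open scoped ENNReal Manifold ContDiff Bundle

noncomputable section

namespace RandomPert

/-- A normalised (smooth) volume on the `n`-dimensional manifold `M`: a Borel probability measure
which in every smooth chart has a smooth, strictly positive density with respect to Lebesgue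
measure. The normalised Riemannian volume of any Riemannian metric on `M` is of this kind. -/
structure IsNormalizedVolume {n : ℕ} {M : Type*} [TopologicalSpace M] [MeasurableSpace M]
    [ChartedSpace (EuclideanSpace ℝ (Fin n)) M] (Leb : Measure M) : Prop where
  isProbabilityMeasure : IsProbabilityMeasure Leb
  density : ∀ e ∈ IsManifold.maximalAtlas (𝓡 n) ∞ M,
    ∃ r : EuclideanSpace ℝ (Fin n) → ℝ,
      ContDiffOn ℝ ∞ r e.target ∧ (∀ y ∈ e.target, 0 < r y) ∧
      ∀ A : Set M, MeasurableSet A → A ⊆ e.source →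
        Leb A = ∫⁻ y in e '' A, ENNReal.ofReal (r y)

section Perturbation

variable {M X : Type*} [MetricSpace M] [MeasurableSpace M] [MetricSpace X] [MeasurableSpace X]

/-- The pair `(F, θ)`, with `f_w(x) = F x w` and `f^x(w) = F x w`, is a random perturbation of `f`:
* `θ` is a Borel probability measure on `X` whose support contains a ball around the parameter
  `w₀` of the unperturbed map, and `f_{w₀} = f`;
* (covering) for a.e. `x` the perturbed images of `x` under the noise cover the ball of radius
  `ρ₀` around `f x`, in the sense that this ball lies in the support of the law `f^x_* θ`
  of the perturbed image;
* (noise distribution) for a.e. `x` the law `f^x_* θ` has a density `q_x`, and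
  `qlow ≤ q_x ≤ qup` a.e. on its support. -/
structure IsRandomPerturbation (Leb : Measure M) (f : M → M) (F : M → X → M) (θ : Measure X) :
    Prop where
  measurable : Measurable (Function.uncurry F)
  isProbabilityMeasure : IsProbabilityMeasure θ
  unperturbed : ∃ w₀ : X, (∃ ε₀ : ℝ, 0 < ε₀ ∧ Metric.ball w₀ ε₀ ⊆ θ.support) ∧
    ∀ x, F x w₀ = f x
  covering : ∃ ρ₀ : ℝ, 0 < ρ₀ ∧
    ∀ᵐ x ∂Leb, Metric.ball (f x) ρ₀ ⊆ (θ.map (F x)).support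
  noise : ∃ qlow qup : ℝ, 0 < qlow ∧ qlow < qup ∧
    ∀ᵐ x ∂Leb, ∃ q : M → ℝ≥0∞, Measurable q ∧ θ.map (F x) = Leb.withDensity q ∧
      ∀ᵐ y ∂Leb, y ∈ (θ.map (F x)).support →
        ENNReal.ofReal qlow ≤ q y ∧ q y ≤ ENNReal.ofReal qup

/-- If `w ↦ f_w(x)` is continuous, the covering condition follows from the pointwise inclusion
of the ball in the image of the support of the noise. -/
theorem subset_support_map_of_continuous [BorelSpace M] [BorelSpace X] {θ : Measure X}
    {g : X → M} (hg : Continuous g) {B : Set M} (hB : B ⊆ g '' θ.support) :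
    B ⊆ (θ.map g).support := by
  intro y hy
  obtain ⟨w, hw, rfl⟩ := hB hy
  rw [(nhds_basis_opens (g w)).mem_measureSupport]
  rintro U ⟨hU, hUo⟩
  rw [Measure.map_apply hg.measurable hUo.measurableSet]
  exact ((nhds_basis_opens w).mem_measureSupport.1 hw) _ ⟨hU, hUo.preimage hg⟩

/-- The random orbit `f^n_w(x) = f_{w_n} ∘ ⋯ ∘ f_{w_1} (x)`, with the noise sequence indexed
from `0`. -/
def randomOrbit (F : M → X → M) (w : ℕ → X) (x : M) : ℕ → M
  | 0 => x
  | n + 1 => F (randomOrbit F w x n) (w n)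

/-- The law `θ^ℕ` of an i.i.d. noise sequence. -/
def noiseLaw (θ : Measure X) : Measure (ℕ → X) := Measure.infinitePi fun _ => θ

/-- `μ` is stationary: it is a probability measure which is invariant on average over the noise. -/
def IsStationary (F : M → X → M) (θ : Measure X) (μ : Measure M) : Prop :=
  IsProbabilityMeasure μ ∧
    ∀ φ : M → ℝ, Integrable φ μ → ∫ w, (∫ x, φ (F x w) ∂μ) ∂θ = ∫ x, φ x ∂μ

/-- The annealed correlation of `φ ∈ L^p(Leb)` and `ψ ∈ L^q(Leb)` with respect to `μ × θ^ℕ`. -/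
def annealedCor (Leb : Measure M) (F : M → X → M) (θ : Measure X) (μ : Measure M) (p q : ℝ≥0∞)
    (φ ψ : M → ℝ) (n : ℕ) : ℝ :=
  ((eLpNorm φ p Leb).toReal * (eLpNorm ψ q Leb).toReal)⁻¹ *
    |∫ x, (∫ w, ψ (randomOrbit F w x n) ∂(noiseLaw θ)) * φ x ∂μ - (∫ x, φ x ∂μ) * ∫ x, ψ x ∂μ|

/-- Exponential annealed decay of correlations for observables in `L^p(Leb)` against observables
in `L^q(Leb)`: all the integrals in the correlation converge, and the correlations are at most
`C Λ^{-n}` with `C` and `Λ > 1` independent of the observables. -/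
def HasExpDecay (Leb : Measure M) (F : M → X → M) (θ : Measure X) (μ : Measure M)
    (p q : ℝ≥0∞) : Prop :=
  ∃ C Λ : ℝ, 0 < C ∧ 1 < Λ ∧ ∀ φ ψ : M → ℝ, MemLp φ p Leb → MemLp ψ q Leb →
    Integrable φ μ ∧ Integrable ψ μ ∧
    ∀ n : ℕ,
      Integrable (fun z : M × (ℕ → X) => ψ (randomOrbit F z.2 z.1 n) * φ z.1)
        (μ.prod (noiseLaw θ)) ∧
      annealedCor Leb F θ μ p q φ ψ n ≤ C * (Λ ^ n)⁻¹

end Perturbation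

end RandomPert

end

/-! The annealed dynamics is the Markov chain with kernel `κ x = θ.map (F x)`. The decisive fact is
Doeblin's condition `c • Leb ≤ (κ ^ N) x` for a.e. `x` (`exists_minorization`). By covering and the
lower density bound, `κ x` dominates a multiple of `Leb` on a fixed-size ball around `f x`. Mass
near an orbit point `y n` can therefore follow the orbit, or first jump to a nearby `y m` and
continue to `y (m + 1)`. Density of the orbit makes this jump relation irreducible and connectedness
of `M` makes it aperiodic (`exists_uniform_length`). Compactness then gives one time and one
constant for finitely many balls covering `M`.

Under Doeblin's condition each block of `N` steps shrinks the essential oscillation of a bounded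
observable by the factor `1 - c`, which yields uniqueness and the exponential rate. An invariant
density comes from the regeneration series of the splitting `P = c m + (P - c m)`. The upper density
bound gives `κ x ≤ qup • Leb`, so one noisy step turns an `L¹` observable into a bounded one; this
handles `ψ ∈ L¹`. -/

noncomputable section

open ProbabilityTheory

namespace RandomPert

/-! ### Irreducibility and aperiodicity of pseudo-orbits along a dense orbit. -/

section Recurrence

/-- A step relation on the indices of a sequence with dense tails in a connected metric space which
allows jumps between nearby points is irreducible and aperiodic. -/
theorem exists_uniform_length {M : Type*} [MetricSpace M] [PreconnectedSpace M] {y : ℕ → M}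
    (hy : ∀ (N : ℕ) (z : M) (ε : ℝ), 0 < ε → ∃ k, N ≤ k ∧ dist (y k) z < ε) {r : ℝ} (hr : 0 < r)
    {R : ℕ → ℕ → ℕ → Prop} (hrefl : ∀ n, R 0 n n)
    (hadd : ∀ {j k a b c}, R j a b → R k b c → R (j + k) a c)
    (hstep : ∀ {m n}, dist (y m) (y n) < r → R 1 n (m + 1)) (s : Finset ℕ)
    (hs : ∀ n ∈ s, 1 ≤ n) : ∃ N, ∀ a ∈ s, ∀ b ∈ s, R N a b := by
  have hwalk : ∀ n k, R k n (n + k) := by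
    intro n k
    induction k with
    | zero => exact hrefl n
    | succ k ih => exact hadd ih (hstep (by simpa using hr))
  -- Walk from `n` until the sequence passes near `y (m - 1)`, then jump to `m`. A jump lands on a
  -- successor, hence `1 ≤ m`.
  have hreach : ∀ n m, 1 ≤ m → ∃ k, R k n m := by
    intro n m hm
    obtain ⟨l, rfl⟩ := Nat.exists_eq_add_of_le' hm
    obtain ⟨k, hk, hd⟩ := hy n (y l) r hr
    obtain ⟨j, rfl⟩ := Nat.exists_eq_add_of_le hk
    exact ⟨j + 1, hadd (hwalk n j) (hstep (by rwa [dist_comm]))⟩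
  set L : Set ℕ := {k | R k 1 1} with hL
  set g := Nat.setGcd L with hg
  -- A circuit from 1 through `n` is a return to 1 both with and without the loop at `n` inserted;
  -- `g` divides both lengths.
  have hcycle : ∀ n c, 1 ≤ n → R c n n → g ∣ c := by
    intro n c hn hc
    obtain ⟨a, ha⟩ := hreach 1 n hn
    obtain ⟨b, hb⟩ := hreach n 1 le_rfl
    have h1 : g ∣ a + b := Nat.setGcd_dvd_of_mem (hadd ha hb)
    have h2 : g ∣ a + c + b := Nat.setGcd_dvd_of_mem (hadd (hadd ha hc) hb)
    have h3 : a + c + b = (a + b) + c := by ring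
    rw [h3] at h2
    exact (Nat.dvd_add_right h1).1 h2
  -- Both `m` and `n` step to `m + 1` in time 1. A return path from there to `n` closes a loop at
  -- `n`, so its length plus 1 is divisible by `g`, and the same total length leads from `m` to `n`.
  have hclose : ∀ m n, 1 ≤ n → dist (y m) (y n) < r → ∃ k, g ∣ k ∧ R k m n := by
    intro m n hn hd
    obtain ⟨k, hk⟩ := hreach (m + 1) n hn
    exact ⟨1 + k, hcycle n _ hn (hadd (hstep hd) hk), hadd (hwalk m 1) hk⟩
  have htrans : ∀ {a b c}, (∃ k, g ∣ k ∧ R k a b) → (∃ k, g ∣ k ∧ R k b c) →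
      ∃ k, g ∣ k ∧ R k a c := by
    rintro a b c ⟨k, hk, hk'⟩ ⟨l, hl, hl'⟩
    exact ⟨k + l, dvd_add hk hl, hadd hk' hl'⟩
  -- By `hclose` the class of 2 modulo `g` spreads to all nearby points, so `A` is clopen and hence
  -- everything.
  set A : Set M := ⋃ n ∈ {n | ∃ k, g ∣ k ∧ R k 2 n}, Metric.ball (y n) (r / 2) with hA
  have hAo : IsOpen A := isOpen_biUnion fun _ _ => Metric.isOpen_ball
  have hAc : IsClosed A := by
    refine isClosed_of_closure_subset fun z hz => ?_
    obtain ⟨z', hz', hzz'⟩ := Metric.mem_closure_iff.1 hz (r / 4) (by positivity)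
    simp only [hA, mem_iUnion, exists_prop, Metric.mem_ball, mem_ofPred_eq] at hz' ⊢
    obtain ⟨n, hn, hd⟩ := hz'
    obtain ⟨k, hk, hkd⟩ := hy 1 z (r / 4) (by positivity)
    refine ⟨k, htrans hn (hclose n k hk ?_), ?_⟩
    · have h1 := dist_triangle (y n) z' z
      have h2 := dist_triangle (y n) z (y k)
      rw [dist_comm z z'] at hzz'
      rw [dist_comm z' (y n)] at hd
      rw [dist_comm (y k) z] at hkd
      linarith
    · rw [dist_comm]; linarith
  have hAu : A = univ := by
    refine IsClopen.eq_univ ⟨hAc, hAo⟩ ⟨y 2, ?_⟩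
    simp only [hA, mem_iUnion, exists_prop, mem_ofPred_eq]
    exact ⟨2, ⟨0, dvd_zero _, hrefl 2⟩, Metric.mem_ball_self (by positivity)⟩
  have h21 : ∃ k, g ∣ k ∧ R k 2 1 := by
    have h1 : y 1 ∈ A := hAu ▸ mem_univ _
    simp only [hA, mem_iUnion, exists_prop, Metric.mem_ball, mem_ofPred_eq] at h1
    obtain ⟨n, hn, hd⟩ := h1
    exact htrans hn (hclose n 1 le_rfl (by rw [dist_comm]; linarith))
  -- The step from 1 to 2 followed by a path back to 1 of length divisible by `g` is a loop at 1.
  have hg1 : g ∣ 1 := by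
    obtain ⟨k, hk, hk'⟩ := h21
    have h := hcycle 1 (1 + k) le_rfl (hadd (hwalk 1 1) hk')
    exact (Nat.dvd_add_left hk).1 h
  -- The return times form an additive semigroup of gcd 1, so they contain all large integers; the
  -- slack is used below to equalise path lengths.
  obtain ⟨t, N₀, ht, hN₀⟩ := Nat.exists_mem_span_nat_finset_of_ge L
  have hlarge : ∀ k, N₀ ≤ k → R k 1 1 := by
    intro k hk
    have hmem := hN₀ k hk (hg1.trans (one_dvd _))
    refine Submodule.span_induction (p := fun x _ => R x 1 1) (fun x hx => ht hx) (hrefl 1)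
      (fun x z _ _ hx hz => hadd hx hz) (fun a x _ hx => ?_) hmem
    induction a with
    | zero => simpa using hrefl 1
    | succ a ih =>
      have h := hadd ih hx
      simpa [add_mul] using h
  choose α hα using fun n => hreach n 1 le_rfl
  have hβ' : ∀ n, ∃ k, 1 ≤ n → R k 1 n := by
    intro n
    by_cases h : 1 ≤ n
    · obtain ⟨k, hk⟩ := hreach 1 n h
      exact ⟨k, fun _ => hk⟩
    · exact ⟨0, fun h' => absurd h' h⟩
  choose β hβ using hβ'
  refine ⟨s.sup α + N₀ + s.sup β, fun a ha b hb => ?_⟩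
  have h1 : α a ≤ s.sup α := Finset.le_sup ha
  have h2 : β b ≤ s.sup β := Finset.le_sup hb
  have h := hadd (hadd (hα a) (hlarge (N₀ + (s.sup α - α a) + (s.sup β - β b)) (by omega)))
    (hβ b (hs b hb))
  convert h using 1
  omega

/-- The tails of a dense orbit in a connected metric space are dense. -/
theorem dense_tail_orbit {M : Type*} [MetricSpace M] [ConnectedSpace M] {f : M → M} {x₀ : M}
    (hdense : Dense {y : M | ∃ n : ℕ, 1 ≤ n ∧ f^[n] x₀ = y}) (N : ℕ) (z : M) (ε : ℝ)
    (hε : 0 < ε) : ∃ k, N ≤ k ∧ dist (f^[k] x₀) z < ε := by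
  rcases subsingleton_or_nontrivial M with h | h
  · exact ⟨N, le_rfl, by rw [Subsingleton.elim (f^[N] x₀) z, dist_self]; exact hε⟩
  -- A nontrivial connected metric space has no isolated points, so deleting finitely many points
  -- keeps the orbit dense.
  · have hfin : ((fun n => f^[n] x₀) '' Iio N).Finite := (finite_Iio N).image _
    obtain ⟨w, ⟨⟨n, hn, rfl⟩, hw⟩, hd⟩ := Metric.dense_iff.1 (hdense.sdiff_finite hfin) z ε hε |>.imp
      fun w hw => And.symm hw
    refine ⟨n, ?_, hd⟩
    by_contra hlt
    exact hw ⟨n, not_le.1 hlt, rfl⟩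

end Recurrence

/-! ### Doeblin's condition. -/

section Minorization

variable {M : Type*} [MeasurableSpace M]

theorem bind_mono_left {μ ν : Measure M} (h : μ ≤ ν) (κ : Kernel M M) : μ.bind κ ≤ ν.bind κ := by
  refine Measure.le_iff.2 fun s hs => ?_
  rw [Measure.bind_apply hs κ.aemeasurable, Measure.bind_apply hs κ.aemeasurable]
  exact lintegral_mono' h le_rfl

theorem pow_add_bind (κ : Kernel M M) (μ : Measure M) (j k : ℕ) :
    μ.bind (κ ^ (j + k) : Kernel M M) = (μ.bind (κ ^ j : Kernel M M)).bind (κ ^ k : Kernel M M) := by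
  rw [Measure.comp_assoc, add_comm, Kernel.pow_add]

theorem pow_add_apply (κ : Kernel M M) (j k : ℕ) (x : M) :
    (κ ^ (j + k)) x = ((κ ^ j) x).bind (κ ^ k : Kernel M M) := by
  rw [add_comm, Kernel.pow_add, Kernel.comp_apply]

/-- **Doeblin's minorization** for a kernel whose transition probabilities charge uniformly the
balls of a fixed radius around the images of a map with a dense orbit of continuity points. -/
theorem exists_minorization [MetricSpace M] [CompactSpace M] [ConnectedSpace M] [BorelSpace M]
    (m : Measure M) [m.IsOpenPosMeasure] {f : M → M} {x₀ : M}
    (hdense : Dense {y : M | ∃ n : ℕ, 1 ≤ n ∧ f^[n] x₀ = y})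
    (hcont : ∀ n : ℕ, 1 ≤ n → ContinuousAt f (f^[n] x₀)) (κ : Kernel M M) {ρ : ℝ} (hρ : 0 < ρ)
    {q : ℝ≥0∞} (hq : q ≠ 0) (hκ : ∀ᵐ x ∂m, q • m.restrict (Metric.ball (f x) ρ) ≤ κ x) :
    ∃ N, 1 ≤ N ∧ ∃ c : ℝ≥0∞, c ≠ 0 ∧ ∀ᵐ x ∂m, c • m ≤ (κ ^ N) x := by
  -- The shift by one excludes `x₀`, where `f` need not be continuous.
  set y : ℕ → M := fun n => f^[n + 1] x₀ with hydef
  have hysucc : ∀ n, y (n + 1) = f (y n) := fun n => Function.iterate_succ_apply' f (n + 1) x₀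
  have hyc : ∀ n, ContinuousAt f (y n) := fun n => hcont (n + 1) (by omega)
  have hy : ∀ (N : ℕ) (z : M) (ε : ℝ), 0 < ε → ∃ k, N ≤ k ∧ dist (y k) z < ε := by
    intro N z ε hε
    obtain ⟨k, hk, hd⟩ := dense_tail_orbit hdense (N + 1) z ε hε
    obtain ⟨l, rfl⟩ := Nat.exists_eq_add_of_le' (le_trans (Nat.le_add_left 1 N) hk)
    exact ⟨l, by omega, hd⟩
  set r := ρ / 2 with hrdef
  have hr : 0 < r := by positivity
  set B : ℕ → Measure M := fun n => m.restrict (Metric.ball (y n) r) with hB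
  set R : ℕ → ℕ → ℕ → Prop := fun k a b =>
    ∃ c : ℝ≥0∞, c ≠ 0 ∧ c • B b ≤ (B a).bind (κ ^ k : Kernel M M) with hR
  have hball : ∀ {x : M} {n : ℕ}, dist (f x) (y n) < r →
      m.restrict (Metric.ball (y n) r) ≤ m.restrict (Metric.ball (f x) ρ) := by
    intro x n h
    refine Measure.restrict_mono (Metric.ball_subset_ball' ?_) le_rfl
    rw [dist_comm]; linarith
  have hstep : ∀ {k n}, dist (y k) (y n) < r → R 1 n (k + 1) := by
    intro k n hd
    have h1 : Metric.ball (y n) r ∈ 𝓝 (y k) := Metric.isOpen_ball.mem_nhds hd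
    have h2 : f ⁻¹' Metric.ball (y (k + 1)) r ∈ 𝓝 (y k) := by
      refine hyc k ?_
      rw [hysucc]
      exact Metric.ball_mem_nhds _ hr
    -- From every point of `U` a single step charges the whole ball around `y (k + 1)`, so `q * m U`
    -- bounds the transferred mass.
    obtain ⟨U, hU, hUo, hUm⟩ := mem_nhds_iff.1 (inter_mem h1 h2)
    refine ⟨q * m U, mul_ne_zero hq (hUo.measure_pos m ⟨_, hUm⟩).ne', ?_⟩
    refine Measure.le_iff.2 fun s hs => ?_
    rw [pow_one, Measure.bind_apply hs κ.aemeasurable]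
    calc ((q * m U) • B (k + 1)) s = ∫⁻ _ in U, q * B (k + 1) s ∂m := by
          simp only [Measure.smul_apply, smul_eq_mul, lintegral_const, Measure.restrict_apply_univ]
          ring
      _ ≤ ∫⁻ x in U, κ x s ∂m := by
          refine lintegral_mono_ae ?_
          filter_upwards [ae_restrict_of_ae hκ, ae_restrict_mem hUo.measurableSet] with x hx hxU
          refine le_trans ?_ (hx s)
          simp only [Measure.smul_apply, smul_eq_mul]
          exact mul_le_mul_right (hball (hU hxU).2 s) q
      _ ≤ ∫⁻ x in Metric.ball (y n) r, κ x s ∂m :=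
          lintegral_mono_set fun x hx => (hU hx).1
  have hadd : ∀ {j k a b c}, R j a b → R k b c → R (j + k) a c := by
    rintro j k a b c ⟨u, hu, hu'⟩ ⟨v, hv, hv'⟩
    refine ⟨u * v, mul_ne_zero hu hv, ?_⟩
    rw [pow_add_bind]
    refine le_trans ?_ (bind_mono_left hu' _)
    rw [Measure.bind_smul, mul_smul]
    refine Measure.le_iff'.2 fun s => ?_
    exact mul_le_mul_right (hv' s) u
  have hrefl : ∀ n, R 0 n n := by
    intro n
    refine ⟨1, one_ne_zero, le_of_eq ?_⟩
    rw [one_smul, pow_zero]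
    exact (Measure.id_comp).symm
  obtain ⟨t, ht⟩ := isCompact_univ.elim_finite_subcover
    (fun n : ℕ => Metric.ball (y (n + 1)) r) (fun _ => Metric.isOpen_ball) (by
      intro z _
      obtain ⟨k, hk, hd⟩ := hy 1 z r hr
      obtain ⟨l, rfl⟩ := Nat.exists_eq_add_of_le' hk
      exact mem_iUnion.2 ⟨l, by rw [Metric.mem_ball, dist_comm]; exact hd⟩)
  obtain ⟨N, hN⟩ := exists_uniform_length hy hr hrefl hadd hstep (t.image (· + 1))
    (by simp)
  have hfin : ∀ T : Finset (ℕ × ℕ), (∀ p ∈ T, R N p.1 p.2) → ∃ c : ℝ≥0∞, c ≠ 0 ∧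
      ∀ p ∈ T, c • B p.2 ≤ (B p.1).bind (κ ^ N : Kernel M M) := by
    intro T
    induction T using Finset.induction_on with
    | empty => exact fun _ => ⟨1, one_ne_zero, by simp⟩
    | insert p T _ ih =>
      intro h
      obtain ⟨c, hc, hcT⟩ := ih fun p' hp' => h p' (Finset.mem_insert_of_mem hp')
      obtain ⟨c', hc', hcp⟩ := h p (Finset.mem_insert_self p T)
      refine ⟨min c c', (lt_min (pos_iff_ne_zero.2 hc) (pos_iff_ne_zero.2 hc')).ne', ?_⟩
      intro p' hp'
      rcases Finset.mem_insert.1 hp' with rfl | hp'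
      · refine le_trans (Measure.le_iff'.2 fun s => ?_) hcp
        exact mul_le_mul_left (min_le_right c c') _
      · refine le_trans (Measure.le_iff'.2 fun s => ?_) (hcT p' hp')
        exact mul_le_mul_left (min_le_left c c') _
  obtain ⟨c, hc, hcT⟩ := hfin (t.image (· + 1) ×ˢ t.image (· + 1)) fun p hp =>
    hN _ (Finset.mem_product.1 hp).1 _ (Finset.mem_product.1 hp).2
  -- The covering balls may overlap; summing the `t.card` lower bounds costs a factor `t.card`.
  have hminor : ∀ a ∈ t, (c / t.card) • m ≤ (B (a + 1)).bind (κ ^ N : Kernel M M) := by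
    intro a ha
    refine Measure.le_iff'.2 fun s => ?_
    have h1 : m s ≤ ∑ b ∈ t, B (b + 1) s := by
      calc m s ≤ m (⋃ b ∈ t, s ∩ Metric.ball (y (b + 1)) r) := by
            refine measure_mono fun z hz => ?_
            obtain ⟨b, hb, hzb⟩ := mem_iUnion₂.1 (ht (mem_univ z))
            exact mem_iUnion₂.2 ⟨b, hb, hz, hzb⟩
        _ ≤ ∑ b ∈ t, m (s ∩ Metric.ball (y (b + 1)) r) := measure_biUnion_finset_le _ _
        _ = ∑ b ∈ t, B (b + 1) s := by
            refine Finset.sum_congr rfl fun b _ => ?_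
            rw [hB, Measure.restrict_apply' Metric.isOpen_ball.measurableSet]
    have h2 : c * m s ≤ (B (a + 1)).bind (κ ^ N : Kernel M M) s * t.card := by
      calc c * m s ≤ ∑ b ∈ t, c * B (b + 1) s := by
            rw [← Finset.mul_sum]; exact mul_le_mul_right h1 c
        _ ≤ ∑ _b ∈ t, (B (a + 1)).bind (κ ^ N : Kernel M M) s :=
            Finset.sum_le_sum fun b hb => hcT (a + 1, b + 1) (Finset.mem_product.2
              ⟨Finset.mem_image_of_mem _ ha, Finset.mem_image_of_mem _ hb⟩) s
        _ = _ := by rw [Finset.sum_const, nsmul_eq_mul, mul_comm]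
    rw [Measure.smul_apply, smul_eq_mul, ENNReal.mul_div_right_comm.symm]
    exact ENNReal.div_le_of_le_mul h2
  -- The extra step carries a point `x` to a full covering ball near `f x`; no continuity at `x` is
  -- needed.
  refine ⟨1 + N, by omega, q * (c / t.card), mul_ne_zero hq
    (ENNReal.div_ne_zero.2 ⟨hc, ENNReal.natCast_ne_top _⟩), ?_⟩
  filter_upwards [hκ] with x hx
  obtain ⟨a, ha, hxa⟩ := mem_iUnion₂.1 (ht (mem_univ (f x)))
  rw [pow_add_apply, pow_one]
  refine le_trans ?_ (bind_mono_left hx _)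
  rw [Measure.bind_smul, mul_smul]
  refine Measure.le_iff'.2 fun s => mul_le_mul_right ?_ q
  exact le_trans (hminor a ha s) (bind_mono_left (hball hxa) _ s)

end Minorization

/-! ### Oscillation contraction, uniqueness and existence of the invariant measure. -/

section Ergodicity

variable {M : Type*} [MeasurableSpace M]

theorem isMarkovKernel_pow (κ : Kernel M M) [IsMarkovKernel κ] (n : ℕ) :
    IsMarkovKernel (κ ^ n) := by
  induction n with
  | zero => rw [pow_zero]; exact inferInstanceAs (IsMarkovKernel Kernel.id)
  | succ n ih => rw [add_comm, Kernel.pow_add, pow_one]; infer_instance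

theorem pow_zero_apply (κ : Kernel M M) (x : M) : (κ ^ 0) x = Measure.dirac x := by
  rw [pow_zero]; exact Kernel.id_apply x

theorem pow_bind_absolutelyContinuous {m : Measure M} {κ : Kernel M M} (hκ : m.bind κ ≪ m)
    (n : ℕ) : m.bind (κ ^ n : Kernel M M) ≪ m := by
  induction n with
  | zero =>
    rw [pow_zero]
    exact Measure.absolutelyContinuous_of_eq Measure.id_comp
  | succ n ih =>
    rw [pow_add_bind, pow_one]
    exact (Measure.AbsolutelyContinuous.comp_right ih κ).trans hκ

theorem pow_bind_eq_self {μ : Measure M} {κ : Kernel M M} (hμ : μ.bind κ = μ) (n : ℕ) :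
    μ.bind (κ ^ n : Kernel M M) = μ := by
  induction n with
  | zero => rw [pow_zero]; exact Measure.id_comp
  | succ n ih => rw [pow_add_bind, pow_one, ih, hμ]

theorem integral_bind_kernel {μ : Measure M} [SFinite μ] {κ : Kernel M M} [IsSFiniteKernel κ]
    {g : M → ℝ} (hg : Integrable g (μ.bind κ)) :
    ∫ y, g y ∂(μ.bind κ) = ∫ x, ∫ y, g y ∂(κ x) ∂μ := by
  rw [Measure.comp_eq_comp_const_apply] at hg ⊢
  rw [Kernel.integral_comp hg, Kernel.const_apply]

theorem integrable_of_ae_mem_Icc {ν : Measure M} [IsFiniteMeasure ν] {g : M → ℝ}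
    (hg : Measurable g) {a b : ℝ} (h : ∀ᵐ y ∂ν, g y ∈ Icc a b) : Integrable g ν :=
  Integrable.of_mem_Icc a b hg.aemeasurable h

theorem integral_mem_Icc {ν : Measure M} [IsProbabilityMeasure ν] {g : M → ℝ}
    (hg : Measurable g) {a b : ℝ} (h : ∀ᵐ y ∂ν, g y ∈ Icc a b) : ∫ y, g y ∂ν ∈ Icc a b := by
  have hi := integrable_of_ae_mem_Icc hg h
  constructor
  · simpa using integral_mono_ae (integrable_const a) hi (h.mono fun _ h => h.1)
  · simpa using integral_mono_ae hi (integrable_const b) (h.mono fun _ h => h.2)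

theorem measurable_integral_kernel (κ : Kernel M M) [IsSFiniteKernel κ] {g : M → ℝ}
    (hg : Measurable g) : Measurable fun x => ∫ y, g y ∂(κ x) :=
  hg.stronglyMeasurable.integral_kernel.measurable

/-- One application of a kernel with a minorization contracts the essential oscillation. -/
theorem exists_Icc_of_minorization {m : Measure M} [IsProbabilityMeasure m] {P : Kernel M M}
    [IsMarkovKernel P] (hP : m.bind P ≪ m) {c : ℝ} (hc : 0 ≤ c)
    (hmin : ∀ᵐ x ∂m, ENNReal.ofReal c • m ≤ P x) {g : M → ℝ} (hg : Measurable g) {a b : ℝ}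
    (hgab : ∀ᵐ x ∂m, g x ∈ Icc a b) :
    ∃ a' b', b' - a' = (1 - c) * (b - a) ∧ ∀ᵐ x ∂m, ∫ y, g y ∂(P x) ∈ Icc a' b' := by
  have hgm := integrable_of_ae_mem_Icc hg hgab
  refine ⟨a + c * (∫ y, g y ∂m - a), b - c * (b - ∫ y, g y ∂m), by ring, ?_⟩
  filter_upwards [hmin, Measure.ae_ae_of_ae_comp (hP.ae_le hgab)] with x hx hgx
  have hgi := integrable_of_ae_mem_Icc hg hgx
  constructor
  -- The minorization is tested on the nonnegative functions `g - a` and, below, `b - g`.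
  · have h := integral_mono_measure hx (f := fun y => g y - a)
      (hgx.mono fun y hy => sub_nonneg.2 hy.1) (hgi.sub (integrable_const a))
    rw [integral_smul_measure, integral_sub hgm (integrable_const a),
      integral_sub hgi (integrable_const a), ENNReal.toReal_ofReal hc] at h
    simp only [integral_const, probReal_univ, smul_eq_mul, one_mul] at h
    linarith
  · have h := integral_mono_measure hx (f := fun y => b - g y)
      (hgx.mono fun y hy => sub_nonneg.2 hy.2) ((integrable_const b).sub hgi)
    rw [integral_smul_measure, integral_sub (integrable_const b) hgm,
      integral_sub (integrable_const b) hgi, ENNReal.toReal_ofReal hc] at h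
    simp only [integral_const, probReal_univ, smul_eq_mul, one_mul] at h
    linarith

theorem exists_Icc_pow_of_minorization {m : Measure M} [IsProbabilityMeasure m] {P : Kernel M M}
    [IsMarkovKernel P] (hP : m.bind P ≪ m) {c : ℝ} (hc : 0 ≤ c)
    (hmin : ∀ᵐ x ∂m, ENNReal.ofReal c • m ≤ P x) {g : M → ℝ} (hg : Measurable g) {a b : ℝ}
    (hgab : ∀ᵐ x ∂m, g x ∈ Icc a b) (k : ℕ) :
    ∃ a' b', b' - a' = (1 - c) ^ k * (b - a) ∧
      ∀ᵐ x ∂m, ∫ y, g y ∂((P ^ k) x) ∈ Icc a' b' := by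
  induction k with
  | zero =>
    refine ⟨a, b, by ring, ?_⟩
    filter_upwards [hgab] with x hx
    rwa [pow_zero_apply, integral_dirac' _ _ hg.stronglyMeasurable]
  | succ k ih =>
    obtain ⟨a', b', hab, h⟩ := ih
    have := isMarkovKernel_pow P k
    have := isMarkovKernel_pow P (1 + k)
    obtain ⟨a'', b'', hab', h'⟩ :=
      exists_Icc_of_minorization hP hc hmin (measurable_integral_kernel (P ^ k) hg) h
    refine ⟨a'', b'', by rw [hab', hab]; ring, ?_⟩
    filter_upwards [h', Measure.ae_ae_of_ae_comp
      ((pow_bind_absolutelyContinuous hP (1 + k)).ae_le hgab)] with x hx hgx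
    have hi := integrable_of_ae_mem_Icc hg hgx
    rw [add_comm k 1]
    rw [pow_add_apply, pow_one] at hi ⊢
    rwa [integral_bind_kernel hi]

/-- Geometric convergence to an invariant measure under a minorization. -/
theorem abs_integral_pow_sub_le {m : Measure M} [IsProbabilityMeasure m] {P : Kernel M M}
    [IsMarkovKernel P] (hP : m.bind P ≪ m) {c : ℝ} (hc : 0 ≤ c)
    (hmin : ∀ᵐ x ∂m, ENNReal.ofReal c • m ≤ P x) {μ : Measure M} [IsProbabilityMeasure μ]
    (hμ : μ.bind P = μ) (hμm : μ ≪ m) {g : M → ℝ} (hg : Measurable g) {a b : ℝ}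
    (hgab : ∀ᵐ x ∂m, g x ∈ Icc a b) (k : ℕ) :
    ∀ᵐ x ∂m, |∫ y, g y ∂((P ^ k) x) - ∫ y, g y ∂μ| ≤ (1 - c) ^ k * (b - a) := by
  have := isMarkovKernel_pow P k
  obtain ⟨a', b', hab, h⟩ := exists_Icc_pow_of_minorization hP hc hmin hg hgab k
  -- By invariance the `μ`-mean of `g` averages the values of `P ^ k` on `g`, so it lies in the same
  -- short interval.
  have hμg : ∫ y, g y ∂μ ∈ Icc a' b' := by
    have hi : Integrable g (μ.bind (P ^ k : Kernel M M)) := by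
      rw [pow_bind_eq_self hμ]
      exact integrable_of_ae_mem_Icc hg (hμm.ae_le hgab)
    rw [← pow_bind_eq_self hμ k, integral_bind_kernel hi]
    exact integral_mem_Icc (measurable_integral_kernel _ hg) (hμm.ae_le h)
  filter_upwards [h] with x hx
  rw [abs_le, ← hab]
  constructor <;> linarith [hx.1, hx.2, hμg.1, hμg.2]

/-- At a common generic point `x`, the numbers `(P ^ k) x s` converge to both `μ s` and `ν s`. -/
theorem eq_of_minorization {m : Measure M} [IsProbabilityMeasure m] {P : Kernel M M}
    [IsMarkovKernel P] (hP : m.bind P ≪ m) {c : ℝ} (hc : 0 < c) (hc1 : c < 1)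
    (hmin : ∀ᵐ x ∂m, ENNReal.ofReal c • m ≤ P x) {μ ν : Measure M} [IsProbabilityMeasure μ]
    [IsProbabilityMeasure ν] (hμ : μ.bind P = μ) (hμm : μ ≪ m) (hν : ν.bind P = ν)
    (hνm : ν ≪ m) : μ = ν := by
  ext s hs
  have hg : Measurable (s.indicator (1 : M → ℝ)) := measurable_one.indicator hs
  have hgab : ∀ᵐ x ∂m, s.indicator (1 : M → ℝ) x ∈ Icc 0 1 := by
    refine Eventually.of_forall fun x => ⟨indicator_nonneg (fun _ _ => zero_le_one) x, ?_⟩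
    exact indicator_le_self' (fun _ _ => zero_le_one) x
  have hle : ∀ k : ℕ, |μ.real s - ν.real s| ≤ 2 * (1 - c) ^ k := by
    intro k
    obtain ⟨x, h1, h2⟩ := ((abs_integral_pow_sub_le hP hc.le hmin hμ hμm hg hgab k).and
      (abs_integral_pow_sub_le hP hc.le hmin hν hνm hg hgab k)).exists
    rw [integral_indicator_one hs, integral_indicator_one hs] at h1 h2
    rw [abs_le] at h1 h2 ⊢
    constructor <;> linarith [h1.1, h1.2, h2.1, h2.2]
  have hlim : Tendsto (fun k : ℕ => 2 * (1 - c) ^ k) atTop (𝓝 0) := by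
    have h := tendsto_pow_atTop_nhds_zero_of_lt_one (r := 1 - c) (by linarith) (by linarith)
    simpa using h.const_mul 2
  have h0 := ge_of_tendsto' hlim hle
  have h1 : μ.real s = ν.real s := sub_eq_zero.1 (abs_nonpos_iff.1 h0)
  exact (measureReal_eq_measureReal_iff).1 h1

/-- The residual measures `m (P - c m)^k` of the splitting of a kernel `P ≥ c m`. -/
def residual (m : Measure M) (P : Kernel M M) (c : ℝ≥0∞) : ℕ → Measure M
  | 0 => m
  | k + 1 => (residual m P c k).bind P - (c * residual m P c k univ) • m

/-- A kernel with a minorization has an absolutely continuous invariant probability measure. -/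
theorem exists_invariant_of_minorization {m : Measure M} [IsProbabilityMeasure m] {P : Kernel M M}
    [IsMarkovKernel P] (hP : m.bind P ≪ m) {c : ℝ≥0∞} (hc : c ≠ 0) (hc1 : c < 1)
    (hmin : ∀ᵐ x ∂m, c • m ≤ P x) :
    ∃ μ : Measure M, IsProbabilityMeasure μ ∧ μ ≪ m ∧ μ.bind P = μ := by
  have hbind : ∀ ν : Measure M, ν ≪ m → (c * ν univ) • m ≤ ν.bind P := by
    intro ν hν
    refine Measure.le_iff.2 fun s hs => ?_
    rw [Measure.bind_apply hs P.aemeasurable]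
    calc ((c * ν univ) • m) s = ∫⁻ _, c * m s ∂ν := by
          simp only [Measure.smul_apply, smul_eq_mul, lintegral_const]; ring
      _ ≤ ∫⁻ x, P x s ∂ν := by
          refine lintegral_mono_ae ?_
          filter_upwards [hν.ae_le hmin] with x hx using hx s
  have hmass : ∀ ν : Measure M, (ν.bind P) univ = ν univ := by
    intro ν
    rw [Measure.bind_apply MeasurableSet.univ P.aemeasurable]
    simp
  have hsucc : ∀ k, residual m P c k ≪ m → residual m P c k univ = (1 - c) ^ k →
      residual m P c (k + 1) + (c * (1 - c) ^ k) • m = (residual m P c k).bind P := by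
    intro k h1 h2
    have hfin : c * (1 - c) ^ k ≠ ⊤ :=
      ENNReal.mul_ne_top hc1.ne_top (ENNReal.pow_ne_top (ENNReal.sub_ne_top ENNReal.one_ne_top))
    have := m.smul_finite hfin
    rw [residual, h2]
    refine Measure.sub_add_cancel_of_le ?_
    rw [← h2]
    exact hbind _ h1
  have hprop : ∀ k, residual m P c k ≪ m ∧ residual m P c k univ = (1 - c) ^ k := by
    intro k
    induction k with
    | zero => exact ⟨Measure.AbsolutelyContinuous.rfl, by simp [residual]⟩
    | succ k ih =>
      constructor
      · exact (Measure.absolutelyContinuous_of_le Measure.sub_le).trans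
          ((Measure.AbsolutelyContinuous.comp_right ih.1 P).trans hP)
      · have h := congrArg (fun ν : Measure M => ν univ) (hsucc k ih.1 ih.2)
        simp only [Measure.add_apply, Measure.smul_apply, measure_univ, smul_eq_mul, mul_one,
          hmass, ih.2] at h
        have hfin : c * (1 - c) ^ k ≠ ⊤ := ENNReal.mul_ne_top hc1.ne_top
          (ENNReal.pow_ne_top (ENNReal.sub_ne_top ENNReal.one_ne_top))
        rw [ENNReal.eq_sub_of_add_eq hfin h, pow_succ', ENNReal.sub_mul, one_mul]
        exact fun _ _ => ENNReal.pow_ne_top (ENNReal.sub_ne_top ENNReal.one_ne_top)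
  have hgeom : ∑' k : ℕ, c * (1 - c) ^ k = 1 := by
    rw [ENNReal.tsum_mul_left, ENNReal.tsum_geometric,
      ENNReal.sub_sub_cancel ENNReal.one_ne_top hc1.le, ENNReal.mul_inv_cancel hc hc1.ne_top]
  refine ⟨Measure.sum fun k => c • residual m P c k, ⟨?_⟩, ?_, ?_⟩
  · rw [Measure.sum_apply _ MeasurableSet.univ, ← hgeom]
    exact tsum_congr fun k => by rw [Measure.smul_apply, (hprop k).2, smul_eq_mul]
  · exact Measure.absolutelyContinuous_sum_left fun k =>
      (Measure.smul_absolutelyContinuous).trans (hprop k).1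
  · rw [Measure.bind_sum _ _ P.aemeasurable]
    ext s hs
    rw [Measure.sum_apply _ hs, Measure.sum_apply _ hs]
    simp only [Measure.bind_smul, Measure.smul_apply, smul_eq_mul]
    -- Applying `P` shifts the series by one term and regenerates `c • m`, its missing zeroth term.
    calc ∑' k, c * ((residual m P c k).bind P) s
        = ∑' k, (c * residual m P c (k + 1) s + (c * (1 - c) ^ k) * (c * m s)) := by
          refine tsum_congr fun k => ?_
          rw [← hsucc k (hprop k).1 (hprop k).2, Measure.add_apply, Measure.smul_apply,
            smul_eq_mul]
          ring
      _ = ∑' k, c * residual m P c (k + 1) s + c * m s := by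
          rw [ENNReal.tsum_add, ENNReal.tsum_mul_right, hgeom, one_mul]
      _ = ∑' k, c * residual m P c k s := by
          rw [tsum_eq_zero_add' (f := fun k => c * residual m P c k s) ENNReal.summable, add_comm]
          rfl

/-- An invariant measure of a power of the kernel is invariant under the kernel itself. -/
theorem exists_invariant_of_pow_minorization {m : Measure M} [IsProbabilityMeasure m]
    {κ : Kernel M M} [IsMarkovKernel κ] (hκ : m.bind κ ≪ m) {N : ℕ} {c : ℝ} (hc : 0 < c)
    (hc1 : c < 1) (hmin : ∀ᵐ x ∂m, ENNReal.ofReal c • m ≤ (κ ^ N) x) :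
    ∃ μ : Measure M, IsProbabilityMeasure μ ∧ μ ≪ m ∧ μ.bind κ = μ := by
  have := isMarkovKernel_pow κ N
  have hP := pow_bind_absolutelyContinuous hκ N
  obtain ⟨μ, hμp, hμm, hμ⟩ := exists_invariant_of_minorization hP
    (ENNReal.ofReal_pos.2 hc).ne' (by simpa using hc1) hmin
  refine ⟨μ, hμp, hμm, ?_⟩
  -- `μ.bind κ` is also invariant under `κ ^ N` and absolutely continuous, so uniqueness identifies
  -- it with `μ`.
  refine eq_of_minorization hP hc hc1 hmin ?_ ?_ hμ hμm
  · rw [← pow_one κ, ← pow_mul, one_mul, ← pow_add_bind, add_comm, pow_add_bind, hμ]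
  · exact (Measure.AbsolutelyContinuous.comp_right hμm κ).trans hκ

/-- Exponential convergence to the invariant measure when a power of the kernel has a
minorization. -/
theorem abs_integral_sub_le_of_pow_minorization {m : Measure M} [IsProbabilityMeasure m]
    {κ : Kernel M M} [IsMarkovKernel κ] (hκ : m.bind κ ≪ m) {N : ℕ} {c : ℝ}
    (hc : 0 ≤ c) (hmin : ∀ᵐ x ∂m, ENNReal.ofReal c • m ≤ (κ ^ N) x) {μ : Measure M}
    [IsProbabilityMeasure μ] (hμ : μ.bind κ = μ) (hμm : μ ≪ m) {g : M → ℝ} (hg : Measurable g)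
    {a b : ℝ} (hgab : ∀ᵐ x ∂m, g x ∈ Icc a b) (n : ℕ) :
    ∀ᵐ x ∂m, |∫ y, g y ∂((κ ^ n) x) - ∫ y, g y ∂μ| ≤ (1 - c) ^ (n / N) * (b - a) := by
  have := isMarkovKernel_pow κ N
  have := isMarkovKernel_pow κ (n % N)
  have := isMarkovKernel_pow κ n
  have := isMarkovKernel_pow (κ ^ N) (n / N)
  -- The remainder steps are absorbed into the observable, preserving its bounds and its `μ`-mean.
  have hpow : κ ^ n = (κ ^ (n % N)) ∘ₖ ((κ ^ N) ^ (n / N)) := by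
    rw [← pow_mul, ← Kernel.pow_add, Nat.mod_add_div]
  have hIcc : ∀ᵐ x ∂m, ∫ y, g y ∂((κ ^ (n % N)) x) ∈ Icc a b := by
    filter_upwards [Measure.ae_ae_of_ae_comp
      ((pow_bind_absolutelyContinuous hκ (n % N)).ae_le hgab)] with x hx
    exact integral_mem_Icc hg hx
  have hμg : ∫ x, ∫ y, g y ∂((κ ^ (n % N)) x) ∂μ = ∫ y, g y ∂μ := by
    rw [← integral_bind_kernel, pow_bind_eq_self hμ]
    rw [pow_bind_eq_self hμ]
    exact integrable_of_ae_mem_Icc hg (hμm.ae_le hgab)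
  filter_upwards [abs_integral_pow_sub_le (pow_bind_absolutelyContinuous hκ N) hc hmin
    (pow_bind_eq_self hμ N) hμm (measurable_integral_kernel (κ ^ (n % N)) hg) hIcc (n / N),
    Measure.ae_ae_of_ae_comp ((pow_bind_absolutelyContinuous hκ n).ae_le hgab)] with x hx hgx
  have hi := integrable_of_ae_mem_Icc hg hgx
  rw [hμg] at hx
  rw [hpow, Kernel.comp_apply] at hi ⊢
  rwa [integral_bind_kernel hi]

/-- Division of the time with a remainder costs only a constant in a geometric rate. -/
theorem pow_div_le {s : ℝ} (hs : 0 < s) (hs1 : s < 1) {N : ℕ} (hN : 1 ≤ N) :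
    ∃ Λ : ℝ, 1 < Λ ∧ ∀ n : ℕ, s ^ (n / N) ≤ s⁻¹ * (Λ ^ n)⁻¹ := by
  have hN0 : N ≠ 0 := by omega
  set u : ℝ := s ^ ((N : ℝ)⁻¹) with hu
  have hu0 : 0 < u := Real.rpow_pos_of_pos hs _
  have hu1 : u < 1 := Real.rpow_lt_one hs.le hs1 (by positivity)
  have huN : u ^ N = s := Real.rpow_inv_natCast_pow hs.le hN0
  refine ⟨u⁻¹, (one_lt_inv₀ hu0).2 hu1, fun n => ?_⟩
  rw [inv_pow, inv_inv]
  have h1 : s ^ (n / N) * s ≤ u ^ n := by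
    rw [← huN, ← pow_mul, ← pow_add]
    refine pow_le_pow_of_le_one hu0.le hu1.le ?_
    have h2 := Nat.mod_add_div n N
    have h3 := Nat.mod_lt n (show 0 < N by omega)
    omega
  rw [inv_mul_eq_div, le_div_iff₀ hs]
  exact h1

end Ergodicity

/-! ### The transition kernel. -/

section Transition

variable {M X : Type*} [MeasurableSpace M] [MeasurableSpace X]

/-- The transition kernel `x ↦ f^x_* θ` of the random perturbation. -/
def transition (F : M → X → M) (θ : Measure X) [SFinite θ]
    (hF : Measurable (Function.uncurry F)) : Kernel M M where
  toFun x := θ.map (F x)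
  measurable' := by
    refine Measure.measurable_of_measurable_coe _ fun s hs => ?_
    have h : ∀ x, (θ.map (F x)) s = θ (Prod.mk x ⁻¹' (Function.uncurry F ⁻¹' s)) := fun x =>
      Measure.map_apply (hF.comp measurable_prodMk_left) hs
    simp_rw [h]
    exact measurable_measure_prodMk_left (hF hs)

theorem transition_apply (F : M → X → M) (θ : Measure X) [SFinite θ]
    (hF : Measurable (Function.uncurry F)) (x : M) : transition F θ hF x = θ.map (F x) := rfl

instance (F : M → X → M) (θ : Measure X) [IsProbabilityMeasure θ]
    (hF : Measurable (Function.uncurry F)) : IsMarkovKernel (transition F θ hF) :=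
  ⟨fun x => Measure.isProbabilityMeasure_map
    (hF.comp measurable_prodMk_left : Measurable (F x)).aemeasurable⟩

theorem map_prod_eq_bind_transition (F : M → X → M) (θ : Measure X) [IsProbabilityMeasure θ]
    (hF : Measurable (Function.uncurry F)) (μ : Measure M) [SFinite μ] :
    (μ.prod θ).map (Function.uncurry F) = μ.bind (transition F θ hF) := by
  ext s hs
  rw [Measure.map_apply hF hs, Measure.prod_apply (hF hs),
    Measure.bind_apply hs (Kernel.aemeasurable _)]
  refine lintegral_congr fun x => ?_
  have hFx : Measurable (F x) := hF.comp measurable_prodMk_left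
  rw [transition_apply, Measure.map_apply hFx hs]
  rfl

end Transition

/-! ### Random orbits as a Markov chain, and stationarity as invariance. -/

section Orbit

variable {M X : Type*} [MeasurableSpace M] [MeasurableSpace X]

instance (θ : Measure X) [IsProbabilityMeasure θ] : IsProbabilityMeasure (noiseLaw θ) := by
  unfold noiseLaw; infer_instance

theorem measurable_randomOrbit {F : M → X → M} (hF : Measurable (Function.uncurry F)) (n : ℕ) :
    Measurable fun z : M × (ℕ → X) => randomOrbit F z.2 z.1 n := by
  induction n with
  | zero => exact measurable_fst
  | succ n ih => exact hF.comp (ih.prodMk ((measurable_pi_apply n).comp measurable_snd))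

theorem randomOrbit_congr {M X : Type*} (F : M → X → M) {w w' : ℕ → X} (x : M) {n : ℕ}
    (h : ∀ i < n, w i = w' i) : randomOrbit F w x n = randomOrbit F w' x n := by
  induction n with
  | zero => rfl
  | succ n ih =>
    rw [randomOrbit, randomOrbit, ih fun i hi => h i (by omega), h n (by omega)]

/-- The random orbit up to time `n` is independent of the noise at time `n`. -/
theorem indepFun_randomOrbit {F : M → X → M} (hF : Measurable (Function.uncurry F))
    (θ : Measure X) [IsProbabilityMeasure θ] (x : M) (n : ℕ) :
    IndepFun (fun w => randomOrbit F w x n) (fun w : ℕ → X => w n) (noiseLaw θ) := by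
  obtain ⟨w₀⟩ : Nonempty X := nonempty_of_isProbabilityMeasure θ
  have hind : iIndepFun (fun (i : ℕ) (w : ℕ → X) => w i) (noiseLaw θ) :=
    iIndepFun_infinitePi (X := fun _ w => w) fun _ => measurable_id
  have h := hind.indepFun_finset (Finset.range n) {n} (by simp) fun i => measurable_pi_apply i
  have h0 : ∀ i : ℕ, Measurable fun v : Finset.range n → X =>
      -- The orbit up to time `n` reads only the coordinates below `n`; the filler `w₀` is never
      -- seen.
      if hi : i ∈ Finset.range n then v ⟨i, hi⟩ else w₀ := by
    intro i
    by_cases hi : i ∈ Finset.range n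
    · simp only [hi, dite_true]
      exact measurable_pi_apply _
    · simp only [hi, dite_false]
      exact measurable_const
  have h1 : Measurable fun v : Finset.range n → X =>
      randomOrbit F (fun i => if hi : i ∈ Finset.range n then v ⟨i, hi⟩ else w₀) x n :=
    (measurable_randomOrbit hF n).comp (measurable_const.prodMk (measurable_pi_lambda _ h0))
  have h2 : Measurable fun v : ({n} : Finset ℕ) → X => v ⟨n, Finset.mem_singleton_self n⟩ :=
    measurable_pi_apply _
  refine (h.comp h1 h2).congr (Eventually.of_forall fun w => ?_) (Eventually.of_forall fun w => rfl)
  exact randomOrbit_congr F x fun i hi => by simp [hi]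

/-- The law of the random orbit at time `n` is given by the `n`-th power of the transition
kernel. -/
theorem map_randomOrbit {F : M → X → M} (hF : Measurable (Function.uncurry F))
    (θ : Measure X) [IsProbabilityMeasure θ] (x : M) (n : ℕ) :
    (noiseLaw θ).map (fun w => randomOrbit F w x n) = (transition F θ hF ^ n) x := by
  have hm : ∀ n, Measurable fun w : ℕ → X => randomOrbit F w x n := fun n =>
    (measurable_randomOrbit hF n).comp measurable_prodMk_left
  induction n with
  | zero =>
    rw [pow_zero_apply]
    simp [randomOrbit, Measure.map_const]
  | succ n ih =>
    have hpair : (noiseLaw θ).map (fun w => (randomOrbit F w x n, w n)) =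
        ((transition F θ hF ^ n) x).prod θ := by
      rw [IndepFun.map_prod_eq_prod_map_map (hm n).aemeasurable
        (measurable_pi_apply n).aemeasurable (indepFun_randomOrbit hF θ x n), ih]
      congr 1
      exact Measure.infinitePi_map_eval (fun _ : ℕ => θ) n
    have := isMarkovKernel_pow (transition F θ hF) n
    rw [pow_add_apply, pow_one, ← map_prod_eq_bind_transition, ← hpair,
      Measure.map_map hF ((hm n).prodMk (measurable_pi_apply n))]
    rfl

theorem measurePreserving_randomOrbit {F : M → X → M} (hF : Measurable (Function.uncurry F))
    (θ : Measure X) [IsProbabilityMeasure θ] {μ : Measure M} [IsProbabilityMeasure μ]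
    (hμ : μ.bind (transition F θ hF) = μ) (n : ℕ) :
    MeasurePreserving (fun z : M × (ℕ → X) => randomOrbit F z.2 z.1 n)
      (μ.prod (noiseLaw θ)) μ := by
  refine ⟨measurable_randomOrbit hF n, ?_⟩
  conv_rhs => rw [← pow_bind_eq_self hμ n]
  ext s hs
  have hmeas := measurable_randomOrbit hF n
  rw [Measure.map_apply hmeas hs, Measure.prod_apply (hmeas hs),
    Measure.bind_apply hs (Kernel.aemeasurable _)]
  refine lintegral_congr fun x => ?_
  have hmx : Measurable fun w : ℕ → X => randomOrbit F w x n :=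
    hmeas.comp measurable_prodMk_left
  rw [← map_randomOrbit hF θ x n, Measure.map_apply hmx hs]
  rfl

/-- A probability measure is stationary if and only if it is invariant under the transition
kernel. -/
theorem isStationary_iff {F : M → X → M} (hF : Measurable (Function.uncurry F))
    (θ : Measure X) [IsProbabilityMeasure θ] {μ : Measure M} :
    IsStationary F θ μ ↔ IsProbabilityMeasure μ ∧ μ.bind (transition F θ hF) = μ := by
  constructor
  · rintro ⟨hp, h⟩
    refine ⟨hp, ?_⟩
    rw [← map_prod_eq_bind_transition]
    have := Measure.isProbabilityMeasure_map (μ := μ.prod θ) hF.aemeasurable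
    ext s hs
    have h1 := h (s.indicator 1) ((integrable_const (1 : ℝ)).indicator hs)
    have hInt : Integrable (Function.uncurry fun (x : M) (w : X) =>
        s.indicator (1 : M → ℝ) (F x w)) (μ.prod θ) := by
      have : Integrable (s.indicator (1 : M → ℝ)) ((μ.prod θ).map (Function.uncurry F)) :=
        (integrable_const (1 : ℝ)).indicator hs
      exact this.comp_measurable hF
    rw [← integral_integral_swap hInt, integral_integral hInt] at h1
    have h2 := integral_map (μ := μ.prod θ) hF.aemeasurable
      (f := s.indicator (1 : M → ℝ)) (measurable_one.indicator hs).aestronglyMeasurable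
    have h3 : ∫ z, s.indicator (1 : M → ℝ) (F z.1 z.2) ∂μ.prod θ =
      ∫ y, s.indicator (1 : M → ℝ) y ∂(μ.prod θ).map (Function.uncurry F) := h2.symm
    rw [h3, integral_indicator_one hs, integral_indicator_one hs] at h1
    exact (measureReal_eq_measureReal_iff).1 h1
  · rintro ⟨hp, h⟩
    refine ⟨hp, fun φ hφ => ?_⟩
    rw [← map_prod_eq_bind_transition] at h
    have hφ' : Integrable φ ((μ.prod θ).map (Function.uncurry F)) := by rwa [h]
    have hInt : Integrable (Function.uncurry fun (x : M) (w : X) => φ (F x w)) (μ.prod θ) :=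
      hφ'.comp_measurable hF
    rw [← integral_integral_swap hInt, integral_integral hInt]
    conv_rhs => rw [← h]
    rw [integral_map hF.aemeasurable hφ'.aestronglyMeasurable]
    rfl

end Orbit

/-! ### Positivity of the volume and density bounds as inequalities of measures. -/

section Volume

/-- A normalised volume charges every nonempty open set. -/
theorem IsNormalizedVolume.isOpenPosMeasure {d : ℕ} {M : Type*} [TopologicalSpace M]
    [MeasurableSpace M] [BorelSpace M] [ChartedSpace (EuclideanSpace ℝ (Fin d)) M]
    [IsManifold (𝓡 d) ∞ M] {Leb : Measure M} (h : IsNormalizedVolume (n := d) Leb) :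
    Leb.IsOpenPosMeasure := by
  refine ⟨fun U hU ⟨x, hx⟩ => ?_⟩
  set e := chartAt (EuclideanSpace ℝ (Fin d)) x with he
  obtain ⟨r, hr, hpos, hA⟩ := h.density e (IsManifold.chart_mem_maximalAtlas x)
  have hV : IsOpen (U ∩ e.source) := hU.inter e.open_source
  have hVim : IsOpen (e '' (U ∩ e.source)) :=
    e.isOpen_image_of_subset_source hV inter_subset_right
  have hsub : e '' (U ∩ e.source) ⊆ e.target := by
    rintro _ ⟨z, hz, rfl⟩
    exact e.map_source hz.2
  intro h0
  have h1 := hA _ hV.measurableSet inter_subset_right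
  rw [measure_mono_null inter_subset_left h0] at h1
  have hmeas : AEMeasurable (fun y => ENNReal.ofReal (r y))
      (volume.restrict (e '' (U ∩ e.source))) :=
    ((hr.continuousOn.mono hsub).aemeasurable hVim.measurableSet).ennreal_ofReal
  have h2 := (lintegral_eq_zero_iff' hmeas).1 h1.symm
  rw [Filter.EventuallyEq, ae_restrict_iff' hVim.measurableSet] at h2
  have h3 : volume (e '' (U ∩ e.source)) = 0 := by
    refine measure_mono_null (fun y hy => ?_) (ae_iff.1 h2)
    intro h4
    have := h4 hy
    simp only [Pi.zero_apply, ENNReal.ofReal_eq_zero] at this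
    exact absurd (hpos y (hsub hy)) (not_lt.2 this)
  exact (hVim.measure_pos volume
    ⟨e x, x, ⟨hx, mem_chart_source _ x⟩, rfl⟩).ne' h3

/-- Second countability makes the complement of the support null, so the density vanishes a.e. there
and the bound on the support becomes global. -/
theorem withDensity_le_smul {M : Type*} [TopologicalSpace M] [SecondCountableTopology M]
    [MeasurableSpace M] [BorelSpace M] {m ν : Measure M} {q : M → ℝ≥0∞} (hq : Measurable q)
    (hν : ν = m.withDensity q) {K : ℝ≥0∞} (h : ∀ᵐ y ∂m, y ∈ ν.support → q y ≤ K) :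
    ν ≤ K • m := by
  have h0 : ∀ᵐ y ∂m, y ∈ ν.supportᶜ → q y = 0 := by
    have h1 : ν ν.supportᶜ = 0 := Measure.measure_compl_support
    have hms : MeasurableSet ν.supportᶜ := Measure.isOpen_compl_support.measurableSet
    have h2 : ∫⁻ y in ν.supportᶜ, q y ∂m = 0 := by
      rw [← withDensity_apply _ hms, ← hν]; exact h1
    exact (ae_restrict_iff' hms).1 ((lintegral_eq_zero_iff hq).1 h2)
  rw [hν, ← withDensity_const]
  refine withDensity_mono ?_
  filter_upwards [h, h0] with y h1 h2
  by_cases hy : y ∈ ν.support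
  · exact h1 hy
  · rw [h2 hy]; exact zero_le

theorem smul_restrict_le_withDensity {M : Type*} [MeasurableSpace M] {m : Measure M}
    {q : M → ℝ≥0∞} {B : Set M}
    (hB : MeasurableSet B) {k : ℝ≥0∞} (h : ∀ᵐ y ∂m, y ∈ B → k ≤ q y) :
    k • m.restrict B ≤ m.withDensity q := by
  refine Measure.le_iff.2 fun s hs => ?_
  rw [withDensity_apply _ hs, Measure.smul_apply, Measure.restrict_apply hs, smul_eq_mul,
    ← setLIntegral_const]
  refine le_trans ?_ (lintegral_mono_set (inter_subset_left (t := B)))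
  refine lintegral_mono_ae ?_
  rw [ae_restrict_iff' (hs.inter hB)]
  filter_upwards [h] with y hy hys using hy hys.2

end Volume

/-! ### Norm estimates. -/

section Norms

variable {M : Type*} [MeasurableSpace M] {m : Measure M}

theorem ae_mem_Icc_of_memLp_top {ψ : M → ℝ} (hψ : MemLp ψ ⊤ m) :
    ∀ᵐ x ∂m, ψ x ∈ Icc (-(eLpNorm ψ ⊤ m).toReal) (eLpNorm ψ ⊤ m).toReal := by
  filter_upwards [ae_le_eLpNormEssSup (f := ψ) (μ := m)] with x hx
  rw [← eLpNorm_exponent_top] at hx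
  have h := ENNReal.toReal_mono hψ.2.ne hx
  rw [toReal_enorm, Real.norm_eq_abs] at h
  exact abs_le.1 h

theorem integral_abs_eq_toReal_eLpNorm {ψ : M → ℝ} (hψ : AEStronglyMeasurable ψ m) :
    ∫ x, |ψ x| ∂m = (eLpNorm ψ 1 m).toReal := by
  rw [eLpNorm_one_eq_lintegral_enorm, ← integral_norm_eq_lintegral_enorm hψ]
  rfl

theorem integral_abs_le_of_le_smul {μ : Measure M} {K : ℝ} (hK : 0 ≤ K)
    (hμ : μ ≤ ENNReal.ofReal K • m) {ψ : M → ℝ} (hψ : Integrable ψ m) :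
    ∫ x, |ψ x| ∂μ ≤ K * (eLpNorm ψ 1 m).toReal := by
  refine (integral_mono_measure hμ (Eventually.of_forall fun _ => abs_nonneg _)
    (hψ.abs.smul_measure ENNReal.ofReal_ne_top)).trans ?_
  rw [integral_smul_measure, ENNReal.toReal_ofReal hK,
    integral_abs_eq_toReal_eLpNorm hψ.aestronglyMeasurable, smul_eq_mul]

end Norms

/-! ### Decay of correlations. -/

section Correlations

variable {M X : Type*} [MeasurableSpace M] [MeasurableSpace X]

/-- Correlations are controlled by the distance of the averaged observable to its mean. -/
theorem abs_correlation_le {F : M → X → M} (hF : Measurable (Function.uncurry F))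
    (θ : Measure X) [IsProbabilityMeasure θ] {μ : Measure M} [IsProbabilityMeasure μ]
    (hμ : μ.bind (transition F θ hF) = μ) {φ ψ ψ' : M → ℝ} (hφ : Integrable φ μ)
    (hψ' : Measurable ψ') (hψψ' : ψ =ᵐ[μ] ψ') {n : ℕ} {E : ℝ}
    (hE : ∀ᵐ x ∂μ, |∫ y, ψ' y ∂((transition F θ hF ^ n) x) - ∫ y, ψ' y ∂μ| ≤ E) :
    |∫ x, (∫ w, ψ (randomOrbit F w x n) ∂(noiseLaw θ)) * φ x ∂μ - (∫ x, φ x ∂μ) * ∫ x, ψ x ∂μ|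
      ≤ E * ∫ x, |φ x| ∂μ := by
  have := isMarkovKernel_pow (transition F θ hF) n
  set D : M → ℝ := fun x => ∫ y, ψ' y ∂((transition F θ hF ^ n) x) - ∫ y, ψ' y ∂μ with hD
  have hDm : Measurable D := (measurable_integral_kernel _ hψ').sub_const _
  have hDφ : Integrable (fun x => D x * φ x) μ :=
    hφ.bdd_mul hDm.aestronglyMeasurable hE
  have hT : ∀ᵐ x ∂μ, ∫ w, ψ (randomOrbit F w x n) ∂(noiseLaw θ) = D x + ∫ y, ψ y ∂μ := by
    -- Invariance of `μ` passes a `μ`-null set to a null set for almost every transition law.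
    have h1 : ∀ᵐ x ∂μ, ∀ᵐ y ∂((transition F θ hF ^ n) x), ψ y = ψ' y := by
      refine Measure.ae_ae_of_ae_comp ?_
      rwa [pow_bind_eq_self hμ]
    filter_upwards [h1] with x hx
    have hmx : Measurable fun w : ℕ → X => randomOrbit F w x n :=
      (measurable_randomOrbit hF n).comp measurable_prodMk_left
    rw [← map_randomOrbit hF θ x n] at hx
    have h2 := ae_of_ae_map hmx.aemeasurable hx
    rw [integral_congr_ae h2, integral_congr_ae hψψ', hD]
    simp only [sub_add_cancel]
    rw [← map_randomOrbit hF θ x n, integral_map hmx.aemeasurable hψ'.aestronglyMeasurable]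
  have hsplit : ∫ x, (∫ w, ψ (randomOrbit F w x n) ∂(noiseLaw θ)) * φ x ∂μ =
      ∫ x, D x * φ x ∂μ + (∫ x, φ x ∂μ) * ∫ x, ψ x ∂μ := by
    rw [mul_comm (∫ x, φ x ∂μ), ← integral_const_mul, ← integral_add hDφ (hφ.const_mul _)]
    refine integral_congr_ae ?_
    filter_upwards [hT] with x hx
    rw [hx, add_mul]
  rw [hsplit, add_sub_cancel_right, ← integral_const_mul]
  refine abs_integral_le_integral_abs.trans (integral_mono_ae hDφ.abs (hφ.abs.const_mul E) ?_)
  filter_upwards [hE] with x hx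
  rw [abs_mul]
  exact mul_le_mul_of_nonneg_right hx (abs_nonneg _)

theorem bind_le_smul {m μ : Measure M} [IsProbabilityMeasure μ] {κ : Kernel M M} {K : ℝ≥0∞}
    (hup : ∀ᵐ x ∂m, κ x ≤ K • m) (hμ : μ ≪ m) : μ.bind κ ≤ K • m := by
  refine Measure.le_iff.2 fun s hs => ?_
  rw [Measure.bind_apply hs κ.aemeasurable]
  calc ∫⁻ x, κ x s ∂μ ≤ ∫⁻ _, (K • m) s ∂μ := by
        refine lintegral_mono_ae ?_
        filter_upwards [hμ.ae_le hup] with x hx using hx s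
    _ = (K • m) s := by simp

/-- Exponential decay of the annealed correlations, from a minorization of a power of the
transition kernel and a bound on its densities. -/
theorem hasExpDecay_of_minorization {m : Measure M} [IsProbabilityMeasure m] {F : M → X → M}
    (hF : Measurable (Function.uncurry F)) (θ : Measure X) [IsProbabilityMeasure θ] {K : ℝ}
    (hK : 0 < K) (hup : ∀ᵐ x ∂m, transition F θ hF x ≤ ENNReal.ofReal K • m)
    (hκ : m.bind (transition F θ hF) ≪ m) {N : ℕ} (hN : 1 ≤ N) {c : ℝ} (hc : 0 < c) (hc1 : c < 1)
    (hmin : ∀ᵐ x ∂m, ENNReal.ofReal c • m ≤ (transition F θ hF ^ N) x) {μ : Measure M}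
    [IsProbabilityMeasure μ] (hμ : μ.bind (transition F θ hF) = μ) (hμm : μ ≪ m)
    (hμK : μ ≤ ENNReal.ofReal K • m) :
    HasExpDecay m F θ μ ⊤ 1 ∧ HasExpDecay m F θ μ 1 ⊤ := by
  obtain ⟨Λ, hΛ, hrate⟩ := pow_div_le (s := 1 - c) (by linarith) (by linarith) hN
  have hs : 0 < 1 - c := by linarith
  have hΛ0 : 0 < Λ := by linarith
  have hInt : ∀ {ψ : M → ℝ}, Integrable ψ m → Integrable ψ μ := fun h =>
    (h.smul_measure ENNReal.ofReal_ne_top).mono_measure hμK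
  have hgap : ∀ {g : M → ℝ}, Measurable g → ∀ {B : ℝ}, (∀ᵐ x ∂m, g x ∈ Icc (-B) B) →
      ∀ n : ℕ, ∀ᵐ x ∂m, |∫ y, g y ∂((transition F θ hF ^ n) x) - ∫ y, g y ∂μ| ≤
        2 * B * ((1 - c)⁻¹ * (Λ ^ n)⁻¹) := by
    intro g hg B hB n
    have hB0 : 0 ≤ B := by
      obtain ⟨x, hx⟩ := hB.exists
      linarith [hx.1, hx.2]
    filter_upwards [abs_integral_sub_le_of_pow_minorization hκ hc.le hmin hμ hμm hg hB n]
      with x hx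
    refine hx.trans ?_
    have h := mul_le_mul_of_nonneg_right (hrate n) (show 0 ≤ 2 * B by positivity)
    calc (1 - c) ^ (n / N) * (B - -B) = (1 - c) ^ (n / N) * (2 * B) := by ring
      _ ≤ _ := h.trans (le_of_eq (by ring))
  have hbdd : ∀ {φ ψ : M → ℝ}, MemLp φ 1 m → MemLp ψ ⊤ m → ∀ n : ℕ,
      |∫ x, (∫ w, ψ (randomOrbit F w x n) ∂(noiseLaw θ)) * φ x ∂μ
        - (∫ x, φ x ∂μ) * ∫ x, ψ x ∂μ| ≤
      ((eLpNorm φ 1 m).toReal * (eLpNorm ψ ⊤ m).toReal) *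
        (2 * K * (1 - c)⁻¹ * (Λ ^ n)⁻¹) := by
    intro φ ψ hφ hψ n
    obtain ⟨ψ', hψ'm, hψψ'⟩ := hψ.1.aemeasurable
    have hB : ∀ᵐ x ∂m, ψ' x ∈ Icc (-(eLpNorm ψ ⊤ m).toReal) (eLpNorm ψ ⊤ m).toReal := by
      filter_upwards [ae_mem_Icc_of_memLp_top hψ, hψψ'] with x hx hx'
      rwa [← hx']
    have hφi := memLp_one_iff_integrable.1 hφ
    have h := abs_correlation_le hF θ hμ (hInt hφi) hψ'm (hμm.ae_eq hψψ')
      (hμm.ae_le (hgap hψ'm hB n))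
    refine h.trans ?_
    calc _ ≤ 2 * (eLpNorm ψ ⊤ m).toReal * ((1 - c)⁻¹ * (Λ ^ n)⁻¹) *
          (K * (eLpNorm φ 1 m).toReal) :=
          mul_le_mul_of_nonneg_left (integral_abs_le_of_le_smul hK.le hμK hφi) (by positivity)
      _ = _ := by ring
  have horb := measurePreserving_randomOrbit hF θ hμ
  have hfst : MeasurePreserving Prod.fst (μ.prod (noiseLaw θ)) μ := measurePreserving_fst
  constructor
  -- The factor `Λ` pays for the one step spent on making `ψ` bounded.
  · refine ⟨2 * K * (1 - c)⁻¹ * Λ, Λ, by positivity, hΛ, fun φ ψ hφ hψ => ?_⟩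
    have hψi := memLp_one_iff_integrable.1 hψ
    have hφi := hφ.integrable le_top
    refine ⟨hInt hφi, hInt hψi, fun n => ⟨?_, ?_⟩⟩
    · refine ((horb n).integrable_comp_of_integrable (hInt hψi)).mul_bdd
        (c := (eLpNorm φ ⊤ m).toReal)
        (hfst.integrable_comp_of_integrable (hInt hφi)).aestronglyMeasurable ?_
      refine hfst.quasiMeasurePreserving.ae (p := fun x => ‖φ x‖ ≤ (eLpNorm φ ⊤ m).toReal) ?_
      filter_upwards [hμm.ae_le (ae_mem_Icc_of_memLp_top hφ)] with x hx using abs_le.2 hx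
    -- This form also covers vanishing norms, where the inverse is 0.
    · refine inv_mul_le_of_le_mul₀ (by positivity) (by positivity) ?_
      -- At time 0 no noise has acted on `ψ`, but the correlation is symmetric and the bound for the
      -- other pairing applies.
      rcases n with _ | n
      · have h := hbdd hψ hφ 0
        simp only [randomOrbit, integral_const, probReal_univ, one_smul] at h ⊢
        have hsym : ∫ x, ψ x * φ x ∂μ - (∫ x, φ x ∂μ) * ∫ x, ψ x ∂μ =
            ∫ x, φ x * ψ x ∂μ - (∫ x, ψ x ∂μ) * ∫ x, φ x ∂μ := by
          simp only [mul_comm]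
        rw [hsym]
        refine h.trans ?_
        rw [mul_comm (eLpNorm ψ 1 m).toReal]
        refine mul_le_mul_of_nonneg_left ?_ (by positivity)
        simp only [pow_zero, inv_one, mul_one]
        exact le_mul_of_one_le_right (by positivity) hΛ.le
      · obtain ⟨ψ', hψ'm, hψψ'⟩ := hψi.aestronglyMeasurable.aemeasurable
        have hψ'i : Integrable ψ' m := hψi.congr hψψ'
        -- One step bounds `g` by `K` times the `L¹` norm of `ψ`; the remaining `n` steps contract
        -- its oscillation.
        set g : M → ℝ := fun x => ∫ y, ψ' y ∂(transition F θ hF x) with hg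
        have hgm : Measurable g := measurable_integral_kernel _ hψ'm
        have hnorm : eLpNorm ψ' 1 m = eLpNorm ψ 1 m := eLpNorm_congr_ae hψψ'.symm
        have hgB : ∀ᵐ x ∂m, g x ∈ Icc (-(K * (eLpNorm ψ 1 m).toReal))
            (K * (eLpNorm ψ 1 m).toReal) := by
          filter_upwards [hup] with x hx
          rw [← hnorm]
          exact abs_le.1 (abs_integral_le_integral_abs.trans
            (integral_abs_le_of_le_smul hK.le hx hψ'i))
        have hE := hμm.ae_le (hgap hgm hgB n)
        have hψ'μ : Integrable ψ' μ := hInt hψ'i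
        have hgμ : ∫ x, g x ∂μ = ∫ y, ψ' y ∂μ := by
          rw [hg, ← integral_bind_kernel, hμ]
          rwa [hμ]
        have := isMarkovKernel_pow (transition F θ hF) n
        have hpow : ∀ᵐ x ∂μ, ∫ y, ψ' y ∂((transition F θ hF ^ (n + 1)) x) =
            ∫ y, g y ∂((transition F θ hF ^ n) x) := by
          have h1 : ∀ᵐ x ∂μ, Integrable ψ' ((transition F θ hF ^ (n + 1)) x) := by
            refine Measure.ae_integrable_of_integrable_comp ?_
            rwa [pow_bind_eq_self hμ]
          filter_upwards [h1] with x hx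
          rw [pow_add_apply, pow_one] at hx ⊢
          rw [integral_bind_kernel hx]
        have h := abs_correlation_le hF θ hμ (hInt hφi) hψ'm (hμm.ae_eq hψψ') (n := n + 1)
          (E := 2 * (K * (eLpNorm ψ 1 m).toReal) * ((1 - c)⁻¹ * (Λ ^ n)⁻¹)) (by
            filter_upwards [hE, hpow] with x hx hx'
            rwa [hx', ← hgμ])
        refine h.trans ?_
        have hφ1 : ∫ x, |φ x| ∂μ ≤ (eLpNorm φ ⊤ m).toReal := by
          have h1 := integral_mono_ae (hInt hφi).abs
            (integrable_const (eLpNorm φ ⊤ m).toReal) (by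
              filter_upwards [hμm.ae_le (ae_mem_Icc_of_memLp_top hφ)] with x hx
                using abs_le.2 hx)
          simpa using h1
        refine (mul_le_mul_of_nonneg_left hφ1 (by positivity)).trans (le_of_eq ?_)
        field_simp
        ring
  · refine ⟨2 * K * (1 - c)⁻¹, Λ, by positivity, hΛ, fun φ ψ hφ hψ => ?_⟩
    have hφi := memLp_one_iff_integrable.1 hφ
    have hψi := hψ.integrable le_top
    refine ⟨hInt hφi, hInt hψi, fun n => ⟨?_, ?_⟩⟩
    · refine (hfst.integrable_comp_of_integrable (hInt hφi)).bdd_mul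
        (c := (eLpNorm ψ ⊤ m).toReal)
        ((horb n).integrable_comp_of_integrable (hInt hψi)).aestronglyMeasurable ?_
      refine (horb n).quasiMeasurePreserving.ae (p := fun x => ‖ψ x‖ ≤ (eLpNorm ψ ⊤ m).toReal) ?_
      filter_upwards [hμm.ae_le (ae_mem_Icc_of_memLp_top hψ)] with x hx using abs_le.2 hx
    · exact inv_mul_le_of_le_mul₀ (by positivity) (by positivity) (hbdd hφ hψ n)

end Correlations

end RandomPert

end

theorem theoremA {d : ℕ} {M : Type*} [MetricSpace M] [CompactSpace M] [ConnectedSpace M]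
    [ChartedSpace (EuclideanSpace ℝ (Fin d)) M] [IsManifold (𝓡 d) ∞ M]
    [Bundle.RiemannianBundle (fun x : M => TangentSpace (𝓡 d) x)]
    [IsContMDiffRiemannianBundle (𝓡 d) ∞ (EuclideanSpace ℝ (Fin d))
      (fun x : M => TangentSpace (𝓡 d) x)]
    [IsRiemannianManifold (𝓡 d) M] [MeasurableSpace M] [BorelSpace M]
    (Leb : Measure M) (hLeb : RandomPert.IsNormalizedVolume (n := d) Leb)
    (f : M → M) (hf : Measurable f) (hfc : ∀ᵐ x ∂Leb, ContinuousAt f x)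
    (x₀ : M) (hdense : Dense {y : M | ∃ n : ℕ, 1 ≤ n ∧ f^[n] x₀ = y})
    (hcont : ∀ n : ℕ, 1 ≤ n → ContinuousAt f (f^[n] x₀))
    {X : Type*} [MetricSpace X] [CompactSpace X] [MeasurableSpace X] [BorelSpace X]
    (F : M → X → M) (θ : Measure X) (hF : RandomPert.IsRandomPerturbation Leb f F θ) :
    ∃ μ : Measure M, RandomPert.IsStationary F θ μ ∧ μ ≪ Leb ∧
      (∀ ν : Measure M, RandomPert.IsStationary F θ ν → ν ≪ Leb → ν = μ) ∧
      RandomPert.HasExpDecay Leb F θ μ ⊤ 1 ∧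
      RandomPert.HasExpDecay Leb F θ μ 1 ⊤ := by
  have := hLeb.isProbabilityMeasure
  have := hLeb.isOpenPosMeasure
  have := hF.isProbabilityMeasure
  have hFm := hF.measurable
  obtain ⟨ρ, hρ, hcov⟩ := hF.covering
  obtain ⟨qlow, qup, hqlow, hlt, hnoise⟩ := hF.noise
  have hup : ∀ᵐ x ∂Leb, RandomPert.transition F θ hFm x ≤ ENNReal.ofReal qup • Leb := by
    filter_upwards [hnoise] with x ⟨q, hq, hmap, hb⟩
    exact RandomPert.withDensity_le_smul hq hmap (hb.mono fun y hy hys => (hy hys).2)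
  have hlow : ∀ᵐ x ∂Leb, ENNReal.ofReal qlow • Leb.restrict (Metric.ball (f x) ρ) ≤
      RandomPert.transition F θ hFm x := by
    filter_upwards [hnoise, hcov] with x ⟨q, hq, hmap, hb⟩ hx
    rw [RandomPert.transition_apply, hmap]
    exact RandomPert.smul_restrict_le_withDensity Metric.isOpen_ball.measurableSet
      (hb.mono fun y hy hyb => (hy (hx hyb)).1)
  obtain ⟨N, hN, c, hc, hmin⟩ := RandomPert.exists_minorization Leb hdense hcont
    (RandomPert.transition F θ hFm) hρ (ENNReal.ofReal_pos.2 hqlow).ne' hlow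
  -- Truncating at one half makes the constant finite and strictly below 1, as the geometric rate
  -- requires.
  have hb : min c 2⁻¹ ≠ ⊤ := ((min_le_right c 2⁻¹).trans_lt (by simp)).ne
  set a : ℝ := (min c 2⁻¹).toReal with ha
  have ha0 : 0 < a := ENNReal.toReal_pos (by simp [hc]) hb
  have ha1 : a < 1 := by
    have h := ENNReal.toReal_mono (by simp) (min_le_right c 2⁻¹)
    rw [ENNReal.toReal_inv, ENNReal.toReal_ofNat] at h
    linarith
  have hmin' : ∀ᵐ x ∂Leb, ENNReal.ofReal a • Leb ≤ (RandomPert.transition F θ hFm ^ N) x := by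
    filter_upwards [hmin] with x hx
    refine le_trans (Measure.le_iff'.2 fun s => ?_) hx
    rw [ha, ENNReal.ofReal_toReal hb]
    exact mul_le_mul_left (min_le_left c 2⁻¹) _
  have hκ : Leb.bind (RandomPert.transition F θ hFm) ≪ Leb :=
    (Measure.absolutelyContinuous_of_le
      (RandomPert.bind_le_smul hup Measure.AbsolutelyContinuous.rfl)).trans
      Measure.smul_absolutelyContinuous
  obtain ⟨μ, hμp, hμL, hμ⟩ := RandomPert.exists_invariant_of_pow_minorization hκ ha0 ha1 hmin'
  -- By invariance `μ` averages transition laws, all but a null set of which obey this bound; hence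
  -- `L¹(Leb)` observables are `μ`-integrable.
  have hμK : μ ≤ ENNReal.ofReal qup • Leb := by
    conv_lhs => rw [← hμ]
    exact RandomPert.bind_le_smul hup hμL
  refine ⟨μ, (RandomPert.isStationary_iff hFm θ).2 ⟨hμp, hμ⟩, hμL, fun ν hν hνL => ?_,
    RandomPert.hasExpDecay_of_minorization hFm θ (hqlow.trans hlt) hup hκ hN ha0 ha1 hmin' hμ
      hμL hμK⟩
  obtain ⟨hνp, hν'⟩ := (RandomPert.isStationary_iff hFm θ).1 hν
  have := RandomPert.isMarkovKernel_pow (RandomPert.transition F θ hFm) N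
  exact RandomPert.eq_of_minorization (RandomPert.pow_bind_absolutelyContinuous hκ N) ha0 ha1
    hmin' (RandomPert.pow_bind_eq_self hν' N) hνL (RandomPert.pow_bind_eq_self hμ N) hμL
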